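/- A permutation $\pi=\pi_1\cdots\pi_n\in\mathfrak S_n$ contains the pattern $\tau\in\mathfrak S_k$ exactly $r$ times if there are exactly $r$ index sequences $1\le i_1<\dots<i_k\le n$ such that $(\pi_{i_1},\dots,\pi_{i_k})$ is order-isomorphic to $\tau$; it avoids $\tau$ if there are none. For $n\ge 2$, a permutation in which rises ($\pi_i<\pi_{i+1}$) and descents ($\pi_i>\pi_{i+1}$) come in turn is called up-up, up-down, down-up or down-down according to whether its first and last steps are (rise, rise), (rise, descent), (descent, rise) or (descent, descent); for $n\le 1$ there are no such permutations. A permutation is alternating if $\pi_i<\pi_{i+1}$ for every odd $i<n$ and $\pi_i>\pi_{i+1}$ for every even $i<n$. Let $UD_k(x)$, $DD_k(x)$, $UU_k(x)$, $DU_k(x)$, $A_k(x)$ be the ordinary generating functions $\sum_{n\ge0}c_nx^n$, where $c_n$ is the number of up-down, down-down, up-up, down-up, alternating permutations in $\mathfrak S_n$, respectively, that avoid $132$ and contain $12\cdots k$ exactly once. Let $U_r$ be the Chebyshev polynomials of the second kind, $U_{-1}=0$, $U_0=1$, $U_r(t)=2tU_{r-1}(t)-U_{r-2}(t)$ for $r\ge1$.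 **Theorem.** For all $k\ge2$, as identities of formal Laurent series over $\mathbb Q$, 1. $\displaystyle UD_k(x)=\frac{x}{U_{k-1}^2\left(\frac1{2x}\right)}$; 2. $\displaystyle DD_k(x)=\frac{1}{U_{k-1}\left(\frac1{2x}\right)}\sum_{m=0}^{k-2}\frac{x^{k-1-m}\left(x^{m+1}+U_{m-1}\left(\frac1{2x}\right)\right)}{U_m\left(\frac1{2x}\right)U_{m+1}\left(\frac1{2x}\right)}$; 3. $\displaystyle UU_k(x)=\frac{1}{U_{k-1}^2\left(\frac1{2x}\right)}$; 4. $\displaystyle DU_k(x)=\frac{1}{x\,U_{k-1}\left(\frac1{2x}\right)}\sum_{m=0}^{k-2}\frac{x^{k-1-m}\left(x^{m+1}+U_{m-1}\left(\frac1{2x}\right)\right)}{U_m\left(\frac1{2x}\right)U_{m+1}\left(\frac1{2x}\right)}$; 5. $\displaystyle A_k(x)=\frac{1+x}{U_{k-1}^2\left(\frac1{2x}\right)}$. -/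

import Mathlib

namespace AltPerm

/-- A strictly increasing choice of positions `f` is an occurrence of the classical pattern `τ` in
`π` if the entries of `π` at these positions are order-isomorphic to `τ`. -/
def IsOccurrence {k n : ℕ} (τ : Equiv.Perm (Fin k)) (π : Equiv.Perm (Fin n))
    (f : Fin k ↪o Fin n) : Prop :=
  ∀ a b : Fin k, π (f a) < π (f b) ↔ τ a < τ b

/-- The number of occurrences of the pattern `τ` in `π`. -/
noncomputable def occurrences {k n : ℕ} (τ : Equiv.Perm (Fin k)) (π : Equiv.Perm (Fin n)) : ℕ :=
  Nat.card {f : Fin k ↪o Fin n // IsOccurrence τ π f}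

/-- `π` avoids `τ`: there is no occurrence of `τ` in `π`. -/
def Avoids {k n : ℕ} (τ : Equiv.Perm (Fin k)) (π : Equiv.Perm (Fin n)) : Prop :=
  ∀ f : Fin k ↪o Fin n, ¬ IsOccurrence τ π f

/-- The pattern `1-3-2`; letters and positions are counted from `0`, so this is `0 ↦ 0`, `1 ↦ 2`,
`2 ↦ 1`. -/
def pattern132 : Equiv.Perm (Fin 3) := Equiv.swap 1 2

/-- The pattern `1-2-⋯-k`. -/
def increasingPattern (k : ℕ) : Equiv.Perm (Fin k) := 1

/-- There is a rise from position `i` to position `i + 1` (positions counted from `0`). -/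
def IsRise {n : ℕ} (π : Equiv.Perm (Fin n)) (i : ℕ) : Prop :=
  ∃ h : i + 1 < n, π ⟨i, Nat.lt_of_succ_lt h⟩ < π ⟨i + 1, h⟩

/-- There is a descent from position `i` to position `i + 1` (positions counted from `0`). -/
def IsDescent {n : ℕ} (π : Equiv.Perm (Fin n)) (i : ℕ) : Prop :=
  ∃ h : i + 1 < n, π ⟨i + 1, h⟩ < π ⟨i, Nat.lt_of_succ_lt h⟩

/-- Rises and descents come in turn. -/
def IsZigzag {n : ℕ} (π : Equiv.Perm (Fin n)) : Prop :=
  ∀ i : ℕ, i + 2 < n → (IsRise π i ↔ IsDescent π (i + 1))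

/-- Up-up permutations: start with a rise and end with a rise. -/
def IsUpUp {n : ℕ} (π : Equiv.Perm (Fin n)) : Prop :=
  2 ≤ n ∧ IsZigzag π ∧ IsRise π 0 ∧ IsRise π (n - 2)

/-- Up-down permutations: start with a rise and end with a descent. -/
def IsUpDown {n : ℕ} (π : Equiv.Perm (Fin n)) : Prop :=
  2 ≤ n ∧ IsZigzag π ∧ IsRise π 0 ∧ IsDescent π (n - 2)

/-- Down-up permutations: start with a descent and end with a rise. -/
def IsDownUp {n : ℕ} (π : Equiv.Perm (Fin n)) : Prop :=
  2 ≤ n ∧ IsZigzag π ∧ IsDescent π 0 ∧ IsRise π (n - 2)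

/-- Down-down permutations: start with a descent and end with a descent. -/
def IsDownDown {n : ℕ} (π : Equiv.Perm (Fin n)) : Prop :=
  2 ≤ n ∧ IsZigzag π ∧ IsDescent π 0 ∧ IsDescent π (n - 2)

/-- Alternating permutations: with positions counted from `0`, the rises are at the even positions
and the descents at the odd positions. -/
def IsAlternating {n : ℕ} (π : Equiv.Perm (Fin n)) : Prop :=
  ∀ i : ℕ, i + 1 < n → (Even i → IsRise π i) ∧ (Odd i → IsDescent π i)

/-- The number of `1-3-2`-avoiding permutations of length `n` in the class `P` that contain `τ`
exactly `r` times. -/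
noncomputable def restrictedCount (P : ∀ {n : ℕ}, Equiv.Perm (Fin n) → Prop) {k : ℕ}
    (τ : Equiv.Perm (Fin k)) (r n : ℕ) : ℕ :=
  Nat.card {π : Equiv.Perm (Fin n) // P π ∧ Avoids pattern132 π ∧ occurrences τ π = r}

/-- The generating function `∑ₙ (restrictedCount P τ r n) xⁿ`, as a formal power series regarded as
a formal Laurent series over `ℚ`. -/
noncomputable def genFun (P : ∀ {n : ℕ}, Equiv.Perm (Fin n) → Prop) {k : ℕ}
    (τ : Equiv.Perm (Fin k)) (r : ℕ) : LaurentSeries ℚ :=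
  ((PowerSeries.mk fun n => (restrictedCount P τ r n : ℚ) : PowerSeries ℚ) : LaurentSeries ℚ)

/-- The variable `x` in the field of formal Laurent series over `ℚ`. -/
noncomputable def x : LaurentSeries ℚ := ((PowerSeries.X : PowerSeries ℚ) : LaurentSeries ℚ)

/-- The Chebyshev polynomial of the second kind `U_r` evaluated at `1 / (2x)`, in the field of
formal Laurent series; `U_{-1} = 0`. -/
noncomputable def chebU (r : ℤ) : LaurentSeries ℚ :=
  (Polynomial.Chebyshev.U (LaurentSeries ℚ) r).eval (1 / (2 * x))

end AltPerm

/-!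
A nonempty `1-3-2`-avoiding permutation splits at its largest letter `m` as `u m v`, where `u` and
`v` avoid `1-3-2` and every letter of `u` exceeds every letter of `v`; conversely any such `u` and
`v` can be glued. Iterating this identifies the `1-3-2`-avoiding permutations of length `n` with the
binary trees with `n` nodes (`word`, `word_injective`, `exists_word_eq`), and both properties in
question can be read off at the root.

* An increasing subsequence of `u m v` of positive length lies in `v`, lies in `u`, or is one in `u`
  followed by `m` (`chainCount_append_cons`). As a unique increasing subsequence of length `k ≥ 1`
  excludes longer ones, `u m v` has exactly one of length `k + 1 ≥ 2` if and only if one of two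
  exclusive alternatives holds: `u` has exactly one of length `k` and `v` none of length `k + 1`, or
  `u` has none of length `k` and `v` has exactly one of length `k + 1`
  (`chainCount_node_eq_one_iff`).
* The step into `m` is a rise and the step out of `m` is a descent, so that alternation of `u m v`
  amounts to alternation of `u` and `v` and a parity condition on the length of `u`
  (`zigzag_append_cons`). The four classes of alternating permutations are therefore indexed by the
  direction of the first step and the parity of the length; words of length at most one are added
  to the classes to make the decomposition uniform, and they do not contribute to the final counts,
  since they contain no increasing pattern of length `k ≥ 2`.

The root decomposition turns into recursions in `k` for the generating functions `shapeGF`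
(`treeGF_eq`). The recursion for permutations avoiding the increasing pattern that start with a
rise and have odd length is `p (k + 1) = x + x * p k * p (k + 1)`, a continued fraction whose
convergents are the quotients `U_{k-1} / U_k` at `1 / (2x)`, by the three-term recurrence of the
Chebyshev polynomials (`shapeLS_up_odd_zero`). All the other recursions are linear with the
coefficient `1 - x * p k` or `1`, and are solved by induction on `k`. For permutations that start
with a descent, the numerators `x ^ (k + 1) + U_{k-1}` come from the avoiders
(`x_mul_shapeLS_down_even_zero`), and each step of the induction contributes one summand
(`chebU_mul_shapeLS_down_even_one`).
-/

namespace AltPerm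

open BinaryTree

/-! ### Increasing subsequences and alternation in words -/

/-- The number of increasing subsequences of length `k` of the word `w`, all of whose entries are at
least `t`. Subsequences are counted by positions. The threshold `t` makes the structural recursion
possible: once the entry `a` is chosen, the rest of the subsequence has to lie above `a`. -/
def chainCount : ℕ → ℕ → List ℕ → ℕ
  | 0, _, _ => 1
  | _ + 1, _, [] => 0
  | k + 1, t, a :: w => chainCount (k + 1) t w + if t ≤ a then chainCount k (a + 1) w else 0

/-- The word `w` alternates between rises and descents; its first step, if there is one, is a rise
for `b = true` and a descent for `b = false`. -/
def Zigzag : Bool → List ℕ → Prop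
  | _, [] => True
  | _, [_] => True
  | true, a :: c :: w => a < c ∧ Zigzag false (c :: w)
  | false, a :: c :: w => c < a ∧ Zigzag true (c :: w)

@[simp] lemma chainCount_zero (t : ℕ) (w : List ℕ) : chainCount 0 t w = 1 := by
  cases w <;> rfl

@[simp] lemma chainCount_succ_nil (k t : ℕ) : chainCount (k + 1) t [] = 0 := rfl

lemma chainCount_succ_cons (k t a : ℕ) (w : List ℕ) : chainCount (k + 1) t (a :: w) =
    chainCount (k + 1) t w + if t ≤ a then chainCount k (a + 1) w else 0 := rfl

lemma chainCount_append_of_lt {u v : List ℕ} (k t : ℕ) (hv : ∀ c ∈ v, c < t) :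
    chainCount k t (u ++ v) = chainCount k t u := by
  induction u generalizing k t with
  | nil =>
    induction v with
    | nil => rfl
    | cons c v ih =>
      cases k with
      | zero => simp
      | succ k =>
        have hc : ¬ t ≤ c := by simpa using hv c (by simp)
        simpa [chainCount_succ_cons, hc] using ih fun c hc => hv c (by simp [hc])
  | cons a u ih =>
    cases k with
    | zero => simp
    | succ k =>
      rw [List.cons_append, chainCount_succ_cons, chainCount_succ_cons, ih _ _ hv]
      split_ifs with h
      · rw [ih k (a + 1) fun c hc => by have := hv c hc; omega]
      · rfl

lemma chainCount_map_add (k t s : ℕ) (w : List ℕ) :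
    chainCount k t (w.map (· + s)) = chainCount k (t - s) w := by
  induction w generalizing k t with
  | nil => cases k <;> rfl
  | cons a w ih =>
    cases k with
    | zero => simp
    | succ k =>
      have h : a + s + 1 - s = a + 1 := by omega
      simp [chainCount_succ_cons, ih, h]

/-- In a word `u m v` with `v < u < m`, an increasing subsequence of positive length lies in `v`,
lies in `u`, or consists of one in `u` followed by `m`. -/
lemma chainCount_append_cons (k t m : ℕ) {u v : List ℕ} (hum : ∀ a ∈ u, a < m)
    (hvm : ∀ c ∈ v, c < m) (hvu : ∀ a ∈ u, ∀ c ∈ v, c < a) (ht : t ≤ m) :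
    chainCount (k + 1) t (u ++ m :: v) =
      chainCount (k + 1) t u + chainCount k t u + chainCount (k + 1) t v := by
  induction u generalizing k t with
  | nil =>
    have h : chainCount k (m + 1) v = chainCount k t [] := by
      rw [← List.nil_append v, chainCount_append_of_lt k (m + 1) fun c hc => by
        have := hvm c hc; omega]
      cases k <;> rfl
    simp [chainCount_succ_cons, ht, h, add_comm]
  | cons a u ih =>
    have hum' : ∀ a ∈ u, a < m := fun b hb => hum b (by simp [hb])
    have hvu' : ∀ a ∈ u, ∀ c ∈ v, c < a := fun b hb => hvu b (by simp [hb])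
    have ham : a < m := hum a (by simp)
    rw [List.cons_append, chainCount_succ_cons, ih k t hum' hvu' ht, chainCount_succ_cons]
    cases k with
    | zero => simp; omega
    | succ k =>
      have h0 : chainCount (k + 1) (a + 1) v = 0 := by
        rw [← List.nil_append v, chainCount_append_of_lt _ (a + 1) fun c hc => by
          have := hvu a (by simp) c hc; omega]
        rfl
      rw [ih k (a + 1) hum' hvu' (by omega), h0, chainCount_succ_cons]
      split_ifs <;> omega

lemma chainCount_eq_zero_of_length_lt {k : ℕ} (t : ℕ) {w : List ℕ} (h : w.length < k) :
    chainCount k t w = 0 := by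
  induction w generalizing k t with
  | nil => obtain ⟨k, rfl⟩ := Nat.exists_eq_succ_of_ne_zero (by simp at h; omega : k ≠ 0); rfl
  | cons a w ih =>
    obtain ⟨k, rfl⟩ := Nat.exists_eq_succ_of_ne_zero (by omega : k ≠ 0)
    simp only [List.length_cons] at h
    simp [chainCount_succ_cons, ih t (show w.length < k + 1 by omega),
      ih (a + 1) (show w.length < k by omega)]

lemma zigzag_map_add (b : Bool) (s : ℕ) (w : List ℕ) : Zigzag b (w.map (· + s)) ↔ Zigzag b w := by
  induction w generalizing b with
  | nil => simp [Zigzag]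
  | cons a w ih =>
    cases w with
    | nil => simp [Zigzag]
    | cons c w => cases b <;> simpa [Zigzag] using fun _ => ih _

lemma zigzag_iff_getElem (b : Bool) (w : List ℕ) : Zigzag b w ↔
    ∀ i (h : i + 1 < w.length), if (Even i ↔ b = true) then w[i] < w[i + 1] else w[i + 1] < w[i] := by
  induction w generalizing b with
  | nil => simp [Zigzag]
  | cons a w ih =>
    cases w with
    | nil => simp [Zigzag]
    | cons c w =>
      have key : ∀ b, (∀ i (h : i + 1 < (a :: c :: w).length), if (Even i ↔ b = true) then
            (a :: c :: w)[i] < (a :: c :: w)[i + 1] else (a :: c :: w)[i + 1] < (a :: c :: w)[i]) ↔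
          (if b = true then a < c else c < a) ∧ Zigzag (!b) (c :: w) := by
        intro b
        rw [ih]
        constructor
        · intro h
          refine ⟨by simpa using h 0 (by simp), fun i hi => ?_⟩
          have := h (i + 1) (by simpa using hi)
          simp only [Nat.even_add_one, List.getElem_cons_succ] at this
          cases b <;> simpa using this
        · rintro ⟨h0, h⟩ i hi
          cases i with
          | zero => simpa using h0
          | succ i =>
            have := h i (by simpa using hi)
            simp only [Nat.even_add_one, List.getElem_cons_succ]
            cases b <;> simpa using this
      rw [key b]
      cases b <;> simp [Zigzag]

/-- If `m` exceeds all other entries of `u m v`, the step into `m` is a rise and the step out of `m`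
is a descent. -/
lemma zigzag_append_cons (m : ℕ) {u v : List ℕ} (hum : ∀ a ∈ u, a < m) (hvm : ∀ c ∈ v, c < m) :
    (Zigzag true (u ++ m :: v) ↔
      (u = [] ∧ v = []) ∨ (Odd u.length ∧ Zigzag true u ∧ Zigzag true v)) ∧
    (Zigzag false (u ++ m :: v) ↔ Even u.length ∧ Zigzag false u ∧ Zigzag true v) := by
  induction u with
  | nil =>
    cases v with
    | nil => simp [Zigzag]
    | cons c v =>
      have := hvm c (by simp)
      simp [Zigzag, this]
      omega
  | cons a u ih =>
    have ham : a < m := hum a (by simp)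
    obtain ⟨ih1, ih2⟩ := ih fun b hb => hum b (by simp [hb])
    cases u with
    | nil =>
      simp only [List.nil_append] at ih1 ih2
      simp [Zigzag, ham, ih2]
      omega
    | cons c u =>
      simp only [List.cons_append] at ih1 ih2
      simp only [List.cons_append, Zigzag, ih1, ih2, List.length_cons, Nat.even_add_one,
        Nat.odd_add_one, Nat.not_odd_iff_even, Nat.not_even_iff_odd]
      constructor <;> simp <;> tauto

/-! ### Binary trees as codes of `1-3-2`-avoiding permutations -/

/-- No three entries of the word form the pattern `1-3-2`. -/
def Avoids132 (w : List ℕ) : Prop := w.Triplewise fun a b c => ¬ (a < c ∧ c < b)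

/-- The `1-3-2`-avoiding permutation, as a word on `0, …, n - 1`, coded by a binary tree with `n`
nodes: the largest letter is at the root, the letters before it form the left subtree and exceed
the letters after it, which form the right subtree. -/
def word : BinaryTree Unit → List ℕ
  | nil => []
  | node _ l r => (word l).map (· + r.numNodes) ++ (l.numNodes + r.numNodes) :: word r

@[simp] lemma length_word (t : BinaryTree Unit) : (word t).length = t.numNodes := by
  induction t with
  | nil => rfl
  | node _ l r hl hr => simp [word, numNodes, hl, hr]; omega

lemma lt_of_mem_word {t : BinaryTree Unit} {a : ℕ} (h : a ∈ word t) : a < t.numNodes := by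
  induction t generalizing a with
  | nil => simp [word] at h
  | node _ l r hl hr =>
    simp only [word, List.mem_append, List.mem_map, List.mem_cons] at h
    simp only [numNodes]
    rcases h with ⟨b, hb, rfl⟩ | rfl | hb
    · have := hl hb; omega
    · omega
    · have := hr hb; omega

lemma left_lt_root {l r : BinaryTree Unit} :
    ∀ a ∈ (word l).map (· + r.numNodes), a < l.numNodes + r.numNodes := by
  simp only [List.mem_map]
  rintro _ ⟨b, hb, rfl⟩
  have := lt_of_mem_word hb
  omega

lemma right_lt_root {l r : BinaryTree Unit} : ∀ c ∈ word r, c < l.numNodes + r.numNodes :=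
  fun _ hc => by have := lt_of_mem_word hc; omega

lemma right_lt_left {l r : BinaryTree Unit} :
    ∀ a ∈ (word l).map (· + r.numNodes), ∀ c ∈ word r, c < a := by
  simp only [List.mem_map]
  rintro _ ⟨b, hb, rfl⟩ c hc
  have := lt_of_mem_word hc
  omega

lemma nodup_word (t : BinaryTree Unit) : (word t).Nodup := by
  induction t with
  | nil => simp [word]
  | node _ l r hl hr =>
    rw [word, List.nodup_append, List.nodup_cons]
    refine ⟨hl.map (add_left_injective _), ⟨fun h => (right_lt_root (l := l) _ h).ne rfl, hr⟩, ?_⟩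
    intro a ha b hb
    rcases List.mem_cons.1 hb with rfl | hb
    · exact (left_lt_root a ha).ne
    · exact (right_lt_left a ha b hb).ne'

lemma avoids132_word (t : BinaryTree Unit) : Avoids132 (word t) := by
  induction t with
  | nil => simp [word, Avoids132]
  | node _ l r hl hr =>
    rw [word, Avoids132, List.triplewise_append, List.triplewise_cons, List.triplewise_map]
    refine ⟨hl.imp (by omega), ⟨?_, hr⟩, fun a ha => ?_, fun c hc => ?_⟩
    · refine List.pairwise_of_forall_mem_list fun b hb c hc => ?_
      have := right_lt_root (l := l) c hc
      omega
    · rw [List.pairwise_cons]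
      refine ⟨fun c hc => ?_, List.pairwise_of_forall_mem_list fun b hb c hc => ?_⟩ <;>
      · have := right_lt_left a ha c hc
        omega
    · refine List.pairwise_of_forall_mem_list fun a ha b hb => ?_
      have h1 := left_lt_root b hb
      rcases List.mem_cons.1 hc with rfl | hc
      · omega
      · have := right_lt_left a ha c hc
        omega

lemma word_injective : Function.Injective word := by
  intro t s h
  have hn : t.numNodes = s.numNodes := by rw [← length_word, h, length_word]
  induction t generalizing s with
  | nil => cases s with
    | nil => rfl
    | node _ l r => simp [numNodes] at hn
  | node _ l r hl hr => cases s with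
    | nil => simp [numNodes] at hn
    | node _ l' r' =>
      simp only [word] at h
      simp only [numNodes] at hn
      have hm : l.numNodes + r.numNodes = l'.numNodes + r'.numNodes := by omega
      rw [hm] at h
      obtain ⟨h1, -, h2⟩ := (List.append_cons_inj_of_notMem
        (fun hc => (left_lt_root (l := l) _ hc).ne hm.symm)
        (fun hc => (right_lt_root (l := l) _ hc).ne hm.symm)).1 h
      have hr' : r.numNodes = r'.numNodes := by rw [← length_word, h2, length_word]
      rw [hr'] at h1
      rw [hl (List.map_injective_iff.2 (add_left_injective _) h1) (by omega), hr h2 hr']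

lemma mem_of_nodup_of_lt {w : List ℕ} (hw : w.Nodup) (hlt : ∀ a ∈ w, a < w.length) {a : ℕ}
    (ha : a < w.length) : a ∈ w := by
  have h : w.toFinset = Finset.range w.length := by
    refine Finset.eq_of_subset_of_card_le (fun a ha => ?_) ?_
    · simpa using hlt a (by simpa using ha)
    · simp [List.toFinset_card_of_nodup hw]
  rw [← List.mem_toFinset, h]
  simpa using ha

/-- A duplicate-free word whose letters form an initial segment of `ℕ` uses the letters
`0, …, length - 1`. -/
lemma lt_length_of_isLowerSet {v : List ℕ} (hv : v.Nodup) (h : ∀ c ∈ v, ∀ d < c, d ∈ v) :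
    ∀ c ∈ v, c < v.length := by
  intro c hc
  have hsub : Finset.range (c + 1) ⊆ v.toFinset := by
    intro d hd
    rw [List.mem_toFinset]
    rcases Nat.lt_succ_iff_lt_or_eq.1 (Finset.mem_range.1 hd) with hd | rfl
    · exact h c hc d hd
    · exact hc
  simpa [List.toFinset_card_of_nodup hv, Nat.succ_le_iff] using Finset.card_le_card hsub

/-- Every `1-3-2`-avoiding permutation comes from a tree. Avoidance, applied to the triples with the
largest letter in the middle, puts every letter before it above every letter after it. -/
lemma exists_word_eq (w : List ℕ) (hw : w.Nodup) (hlt : ∀ a ∈ w, a < w.length)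
    (hav : Avoids132 w) : ∃ t, word t = w := by
  induction hn : w.length using Nat.strong_induction_on generalizing w with
  | _ N ih =>
    subst hn
    rcases Nat.eq_zero_or_pos w.length with h0 | hpos
    · exact ⟨nil, by simpa [word, eq_comm] using h0⟩
    obtain ⟨u, v, huv⟩ := List.append_of_mem
      (mem_of_nodup_of_lt hw hlt (Nat.sub_lt hpos one_pos))
    have hlen : w.length = u.length + v.length + 1 := by
      conv_lhs => rw [huv]
      simp only [List.length_append, List.length_cons]
      omega
    have hm : w.length - 1 = u.length + v.length := by omega
    rw [hm] at huv
    have hall : ∀ a, a < u.length + v.length + 1 → a ∈ u ∨ a = u.length + v.length ∨ a ∈ v := by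
      intro a ha
      have := mem_of_nodup_of_lt hw hlt (hlen ▸ ha)
      rw [huv] at this
      simpa using this
    rw [hlen] at hlt
    rw [huv, Avoids132, List.triplewise_append, List.triplewise_cons] at hav
    obtain ⟨hu132, ⟨-, hv132⟩, havu, -⟩ := hav
    rw [huv, List.nodup_append, List.nodup_cons] at hw
    obtain ⟨hu, ⟨hmv, hv⟩, hdis⟩ := hw
    have hultm : ∀ a ∈ u, a < u.length + v.length := fun a ha => by
      have h1 := hlt a (by rw [huv]; simp [ha])
      have h2 := hdis a ha _ (List.mem_cons_self)
      omega
    have hvltm : ∀ c ∈ v, c < u.length + v.length := fun c hc => by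
      have h1 := hlt c (by rw [huv]; simp [hc])
      have h2 : c ≠ u.length + v.length := fun h => hmv (h ▸ hc)
      omega
    have hvu : ∀ a ∈ u, ∀ c ∈ v, c < a := fun a ha c hc => by
      have h1 := (List.pairwise_cons.1 (havu a ha)).1 c hc
      have h2 := hdis a ha c (List.mem_cons_of_mem _ hc)
      have h3 := hvltm c hc
      omega
    have hvlow : ∀ c ∈ v, ∀ d < c, d ∈ v := fun c hc d hd => by
      have h1 := hvltm c hc
      rcases hall d (by omega) with h | h | h
      · have := hvu d h c hc; omega
      · omega
      · exact h
    have hvlt := lt_length_of_isLowerSet hv hvlow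
    have huge : ∀ a ∈ u, v.length ≤ a := fun a ha => by
      by_contra! h
      have := hvu a ha a (mem_of_nodup_of_lt hv hvlt h)
      omega
    obtain ⟨r, hr⟩ := ih v.length (by omega) v hv hvlt hv132 rfl
    -- The letters of `u` are at least `|v|`, so the truncated subtraction loses nothing.
    have hback : (u.map (· - v.length)).map (· + v.length) = u := by
      rw [List.map_map]
      refine (List.map_congr_left fun a ha => ?_).trans (List.map_id u)
      have := huge a ha
      simp only [Function.comp, id]
      omega
    obtain ⟨l, hl⟩ := ih u.length (by omega) (u.map (· - v.length))
      (List.Nodup.of_map (· + v.length) (by rwa [hback]))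
      (fun a ha => by
        obtain ⟨b, hb, rfl⟩ := List.mem_map.1 ha
        have h1 := hultm b hb
        have h2 := huge b hb
        simp only [List.length_map]
        omega)
      (by
        rw [← hback, List.triplewise_map] at hu132
        exact hu132.imp (by omega)) (by simp)
    have hlc : l.numNodes = u.length := by rw [← length_word, hl, List.length_map]
    have hrc : r.numNodes = v.length := by rw [← length_word, hr]
    exact ⟨node () l r, by rw [word, hlc, hrc, hl, hr, hback, ← huv]⟩

/-! ### One-line notation -/

/-- One-line notation of a permutation, as a word on the letters `0, …, n - 1`. -/
def oneLine {n : ℕ} (π : Equiv.Perm (Fin n)) : List ℕ := List.ofFn fun i => (π i : ℕ)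

@[simp] lemma length_oneLine {n : ℕ} (π : Equiv.Perm (Fin n)) : (oneLine π).length = n := by
  simp [oneLine]

@[simp] lemma getElem_oneLine {n : ℕ} (π : Equiv.Perm (Fin n)) (i : ℕ)
    (h : i < (oneLine π).length) : (oneLine π)[i] = π ⟨i, by simpa using h⟩ := by
  simp [oneLine]

lemma oneLine_injective (n : ℕ) : Function.Injective (oneLine (n := n)) := by
  intro π σ h
  ext i
  exact congrFun (List.ofFn_injective h) i

lemma nodup_oneLine {n : ℕ} (π : Equiv.Perm (Fin n)) : (oneLine π).Nodup :=
  List.nodup_ofFn.2 (Fin.val_injective.comp π.injective)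

lemma lt_of_mem_oneLine {n : ℕ} (π : Equiv.Perm (Fin n)) : ∀ a ∈ oneLine π, a < n := by
  intro a ha
  obtain ⟨i, rfl⟩ := List.mem_ofFn.1 ha
  exact (π i).isLt

lemma exists_oneLine_eq {n : ℕ} {w : List ℕ} (hn : w.length = n) (hw : w.Nodup)
    (hlt : ∀ a ∈ w, a < n) : ∃ π : Equiv.Perm (Fin n), oneLine π = w := by
  subst hn
  let f : Fin w.length → Fin w.length := fun i => ⟨w[i], hlt _ (List.getElem_mem _)⟩
  have hf : Function.Injective f := fun i j h => by
    have := hw.getElem_inj_iff.1 (Fin.mk.inj h)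
    exact Fin.ext this
  refine ⟨Equiv.ofBijective f (Finite.injective_iff_bijective.1 hf), ?_⟩
  refine List.ext_getElem (by simp) fun i h1 h2 => ?_
  simp [f]

lemma isOccurrence_pattern132_iff {n : ℕ} (π : Equiv.Perm (Fin n)) (f : Fin 3 ↪o Fin n) :
    IsOccurrence pattern132 π f ↔ π (f 0) < π (f 2) ∧ π (f 2) < π (f 1) := by
  have h0 : pattern132 0 = 0 := by decide
  have h1 : pattern132 1 = 2 := by decide
  have h2 : pattern132 2 = 1 := by decide
  constructor
  · intro h
    exact ⟨(h 0 2).2 (by rw [h0, h2]; decide), (h 2 1).2 (by rw [h1, h2]; decide)⟩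
  · rintro ⟨h02, h21⟩ a b
    fin_cases a <;> fin_cases b <;> simp [h0, h1, h2, h02, h21, h02.trans h21, h02.le, h21.le,
      (h02.trans h21).le]

lemma avoids_pattern132_iff {n : ℕ} (π : Equiv.Perm (Fin n)) :
    Avoids pattern132 π ↔ Avoids132 (oneLine π) := by
  simp only [Avoids, isOccurrence_pattern132_iff, Avoids132, List.triplewise_iff_getElem,
    getElem_oneLine, length_oneLine, Fin.val_fin_lt]
  constructor
  · intro h i j k hij hjk hk
    refine h (OrderEmbedding.ofStrictMono
      ![⟨i, by omega⟩, ⟨j, by omega⟩, ⟨k, hk⟩] ?_)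
    intro a b hab
    fin_cases a <;> fin_cases b <;> simp_all
    omega
  · intro h f
    exact h (f 0) (f 1) (f 2) (f.strictMono (by decide)) (f.strictMono (by decide)) (f 2).isLt

/-! ### Occurrences of increasing patterns -/

/-- The increasing choices of `k` positions at which `w` is increasing with entries at least `t`. -/
def chains (k t : ℕ) {n : ℕ} (w : Fin n → ℕ) : Set (Fin k ↪o Fin n) :=
  {f | StrictMono (w ∘ f) ∧ ∀ a, t ≤ w (f a)}

/-- Positions after the first one. -/
def tailEmb (k : ℕ) {n : ℕ} (g : Fin k ↪o Fin n) : Fin k ↪o Fin (n + 1) :=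
  g.trans (Fin.succOrderEmb n)

/-- The first position, followed by later ones. -/
def consEmb (k : ℕ) {n : ℕ} (g : Fin k ↪o Fin n) : Fin (k + 1) ↪o Fin (n + 1) :=
  OrderEmbedding.ofStrictMono (Fin.cons 0 fun i => (g i).succ) (by
    intro a b hab
    induction a using Fin.cases with
    | zero =>
      induction b using Fin.cases with
      | zero => simp at hab
      | succ b => simp
    | succ a =>
      induction b using Fin.cases with
      | zero => simp at hab
      | succ b => simpa using hab)

@[simp] lemma tailEmb_apply {k n : ℕ} (g : Fin k ↪o Fin n) (i : Fin k) :
    tailEmb k g i = (g i).succ := rfl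

@[simp] lemma consEmb_zero {k n : ℕ} (g : Fin k ↪o Fin n) : consEmb k g 0 = 0 := rfl

@[simp] lemma consEmb_succ {k n : ℕ} (g : Fin k ↪o Fin n) (i : Fin k) :
    consEmb k g i.succ = (g i).succ := rfl

lemma tailEmb_injective (k n : ℕ) : Function.Injective (tailEmb k (n := n)) := by
  intro g h hgh
  ext i
  have := DFunLike.congr_fun hgh i
  simpa [Fin.ext_iff] using this

lemma consEmb_injective (k n : ℕ) : Function.Injective (consEmb k (n := n)) := by
  intro g h hgh
  ext i
  have := DFunLike.congr_fun hgh i.succ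
  simpa [Fin.ext_iff] using this

lemma exists_tailEmb_eq {k n : ℕ} (f : Fin k ↪o Fin (n + 1)) (hf : ∀ i, f i ≠ 0) :
    ∃ g, tailEmb k g = f := by
  refine ⟨OrderEmbedding.ofStrictMono (fun i => (f i).pred (hf i)) fun a b hab => ?_, ?_⟩
  · simpa using hab
  · ext i
    exact congrArg Fin.val (Fin.succ_pred (f i) (hf i))

lemma exists_consEmb_eq {k n : ℕ} (f : Fin (k + 1) ↪o Fin (n + 1)) (hf : f 0 = 0) :
    ∃ g, consEmb k g = f := by
  have h : ∀ i : Fin k, f i.succ ≠ 0 := fun i => by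
    have : f 0 < f i.succ := f.strictMono (Fin.succ_pos i)
    rw [hf] at this
    exact this.ne'
  refine ⟨OrderEmbedding.ofStrictMono (fun i => (f i.succ).pred (h i)) fun a b hab => ?_, ?_⟩
  · simpa using hab
  · ext i
    induction i using Fin.cases with
    | zero => simp [hf]
    | succ i => exact congrArg Fin.val (Fin.succ_pred (f i.succ) (h i))

lemma tailEmb_mem_chains {k t n : ℕ} {w : Fin (n + 1) → ℕ} {g : Fin k ↪o Fin n} :
    tailEmb k g ∈ chains k t w ↔ g ∈ chains k t fun i => w i.succ := Iff.rfl

lemma consEmb_mem_chains {k t n : ℕ} {w : Fin (n + 1) → ℕ} {g : Fin k ↪o Fin n} :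
    consEmb k g ∈ chains (k + 1) t w ↔ t ≤ w 0 ∧ g ∈ chains k (w 0 + 1) fun i => w i.succ := by
  simp only [chains, Set.mem_ofPred_eq, Fin.forall_fin_succ, consEmb_zero, consEmb_succ]
  constructor
  · rintro ⟨hm, h0, -⟩
    exact ⟨h0, fun a b hab => hm (Fin.succ_lt_succ_iff.2 hab), fun a => hm (Fin.succ_pos a)⟩
  · rintro ⟨h0, hm, h⟩
    refine ⟨fun a b hab => ?_, h0, fun a => by have := h a; omega⟩
    induction b using Fin.cases with
    | zero => simp at hab
    | succ b =>
      induction a using Fin.cases with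
      | zero => exact h b
      | succ a => exact hm (Fin.succ_lt_succ_iff.1 hab)

lemma ncard_chains_zero (t : ℕ) {n : ℕ} (w : Fin n → ℕ) : (chains 0 t w).ncard = 1 := by
  have : chains 0 t w = {RelEmbedding.ofIsEmpty _ _} := by
    ext f
    simp only [chains, Set.mem_ofPred_eq, StrictMono, IsEmpty.forall_iff, and_self,
      Set.mem_singleton_iff, true_iff]
    ext i
    exact i.elim0
  rw [this, Set.ncard_singleton]

lemma ncard_chains (k t : ℕ) {n : ℕ} (w : Fin n → ℕ) :
    (chains k t w).ncard = chainCount k t (List.ofFn w) := by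
  induction n generalizing k t with
  | zero =>
    cases k with
    | zero => rw [ncard_chains_zero, chainCount_zero]
    | succ k =>
      have : chains (k + 1) t w = ∅ := Set.eq_empty_of_forall_notMem fun f => (f 0).elim0
      simp [this]
  | succ n ih =>
    cases k with
    | zero => rw [ncard_chains_zero, chainCount_zero]
    | succ k =>
      have hsplit : chains (k + 1) t w =
          tailEmb (k + 1) '' chains (k + 1) t (fun i => w i.succ) ∪
          consEmb k '' {g | t ≤ w 0 ∧ g ∈ chains k (w 0 + 1) fun i => w i.succ} := by
        ext f
        constructor
        · intro hf
          by_cases h0 : f 0 = 0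
          · obtain ⟨g, rfl⟩ := exists_consEmb_eq f h0
            exact Or.inr ⟨g, consEmb_mem_chains.1 hf, rfl⟩
          · obtain ⟨g, rfl⟩ := exists_tailEmb_eq f fun i h =>
              h0 (le_antisymm (h ▸ f.monotone (Fin.zero_le i)) (Fin.zero_le _))
            exact Or.inl ⟨g, tailEmb_mem_chains.1 hf, rfl⟩
        · rintro (⟨g, hg, rfl⟩ | ⟨g, hg, rfl⟩)
          · exact tailEmb_mem_chains.2 hg
          · exact consEmb_mem_chains.2 hg
      rw [hsplit, Set.ncard_union_eq, Set.ncard_image_of_injective _ (tailEmb_injective _ _),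
        Set.ncard_image_of_injective _ (consEmb_injective _ _), ih, List.ofFn_succ,
        chainCount_succ_cons]
      · split_ifs with h
        · simp [h, ih]
        · simp [h]
      · rw [Set.disjoint_left]
        rintro _ ⟨g, -, rfl⟩ ⟨g', -, h⟩
        have := DFunLike.congr_fun h 0
        simp [Fin.ext_iff] at this

lemma occurrences_increasingPattern {n : ℕ} (k : ℕ) (π : Equiv.Perm (Fin n)) :
    occurrences (increasingPattern k) π = chainCount k 0 (oneLine π) := by
  rw [oneLine, ← ncard_chains, occurrences, ← Nat.card_coe_set_eq]
  refine Nat.card_congr (Equiv.subtypeEquivRight fun f => ?_)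
  simp only [IsOccurrence, increasingPattern, chains, Equiv.Perm.coe_one, id, Set.mem_ofPred_eq,
    zero_le, implies_true, and_true]
  constructor
  · exact fun h a b hab => (h a b).2 hab
  · exact fun h a b => h.lt_iff_lt (a := a) (b := b)

/-! ### Rises and descents of a permutation -/

lemma zigzag_oneLine_iff {n : ℕ} (b : Bool) (π : Equiv.Perm (Fin n)) : Zigzag b (oneLine π) ↔
    ∀ i, i + 1 < n → (IsRise π i ↔ (Even i ↔ b = true)) := by
  rw [zigzag_iff_getElem]
  simp only [length_oneLine, getElem_oneLine, Fin.val_fin_lt]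
  refine forall_congr' fun i => forall_congr' fun hi => ?_
  have hne : π ⟨i, by omega⟩ ≠ π ⟨i + 1, hi⟩ := fun h => by
    simpa using π.injective h
  have hr : IsRise π i ↔ π ⟨i, by omega⟩ < π ⟨i + 1, hi⟩ := ⟨fun h => h.2, fun h => ⟨hi, h⟩⟩
  rw [hr]
  by_cases hp : (Even i ↔ b = true)
  · simp [hp]
  · simp only [hp, if_false, iff_false, not_lt]
    exact ⟨le_of_lt, fun h => lt_of_le_of_ne h hne.symm⟩

lemma isDescent_iff_not_isRise {n : ℕ} (π : Equiv.Perm (Fin n)) {i : ℕ} (hi : i + 1 < n) :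
    IsDescent π i ↔ ¬ IsRise π i := by
  have hne : π ⟨i, by omega⟩ ≠ π ⟨i + 1, hi⟩ := fun h => by
    simpa using π.injective h
  have hr : IsRise π i ↔ π ⟨i, by omega⟩ < π ⟨i + 1, hi⟩ := ⟨fun h => h.2, fun h => ⟨hi, h⟩⟩
  have hd : IsDescent π i ↔ π ⟨i + 1, hi⟩ < π ⟨i, by omega⟩ := ⟨fun h => h.2, fun h => ⟨hi, h⟩⟩
  exact hd.trans (Iff.trans ⟨fun h => h.asymm, fun h => lt_of_le_of_ne (not_lt.1 h) hne.symm⟩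
    (not_congr hr).symm)

/-- In a zigzag permutation, the direction of the first step determines the whole shape. -/
lemma isZigzag_and_iff {n : ℕ} (hn : 2 ≤ n) (b : Bool) (π : Equiv.Perm (Fin n)) :
    (IsZigzag π ∧ (IsRise π 0 ↔ b = true)) ↔ Zigzag b (oneLine π) := by
  rw [zigzag_oneLine_iff]
  constructor
  · rintro ⟨hz, h0⟩ i
    induction i with
    | zero => intro; simpa using h0
    | succ i ih =>
      intro hi
      have h1 := ih (by omega)
      have h2 := hz i (by omega)
      rw [isDescent_iff_not_isRise π (by omega)] at h2
      rw [Nat.even_add_one]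
      tauto
  · intro h
    refine ⟨fun i hi => ?_, by simpa using h 0 (by omega)⟩
    rw [isDescent_iff_not_isRise π (by omega), h i (by omega), h (i + 1) (by omega),
      Nat.even_add_one]
    tauto

lemma isRise_last_iff {n : ℕ} (hn : 2 ≤ n) {b : Bool} {π : Equiv.Perm (Fin n)}
    (h : Zigzag b (oneLine π)) : IsRise π (n - 2) ↔ (Even n ↔ b = true) := by
  rw [(zigzag_oneLine_iff b π).1 h (n - 2) (by omega), Nat.even_sub hn]
  simp

/-! ### The statistics of a tree -/

lemma chainCount_word_node (k : ℕ) (l r : BinaryTree Unit) :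
    chainCount (k + 1) 0 (word (l △ r)) =
      chainCount (k + 1) 0 (word l) + chainCount k 0 (word l) + chainCount (k + 1) 0 (word r) := by
  rw [word, chainCount_append_cons k 0 _ left_lt_root right_lt_root right_lt_left (Nat.zero_le _)]
  simp [chainCount_map_add]

lemma chainCount_succ_eq_zero {k : ℕ} {t : BinaryTree Unit} (h : chainCount k 0 (word t) = 0) :
    chainCount (k + 1) 0 (word t) = 0 := by
  induction t generalizing k with
  | nil => rfl
  | node _ l r hl hr =>
    cases k with
    | zero => simp at h
    | succ k =>
      rw [chainCount_word_node] at h ⊢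
      have h1 := @hl (k + 1) (by omega)
      have h2 := @hr (k + 1) (by omega)
      omega

/-- A permutation with a unique increasing subsequence of some positive length has none that is
longer, since a longer one would contain several of that length. -/
lemma chainCount_eq_zero_of_eq_one {k : ℕ} {t : BinaryTree Unit}
    (h : chainCount (k + 1) 0 (word t) = 1) : chainCount (k + 2) 0 (word t) = 0 := by
  induction t generalizing k with
  | nil => rfl
  | node _ l r hl hr =>
    have hc : chainCount (k + 2) 0 (word (l △ r)) = chainCount (k + 2) 0 (word l) +
      chainCount (k + 1) 0 (word l) + chainCount (k + 2) 0 (word r) := chainCount_word_node _ l r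
    rw [chainCount_word_node] at h
    rw [hc]
    by_cases h1 : chainCount (k + 1) 0 (word l) = 0
    · have h2 : chainCount (k + 2) 0 (word l) = 0 := chainCount_succ_eq_zero h1
      by_cases h3 : chainCount (k + 1) 0 (word r) = 0
      · have h4 : chainCount (k + 2) 0 (word r) = 0 := chainCount_succ_eq_zero h3
        omega
      · have h4 := @hr k (by omega)
        omega
    -- Here the summands for lengths `k + 1` and `k` in `l` are both positive, so the count is at
    -- least two.
    · have h2 : chainCount k 0 (word l) ≠ 0 := fun h => h1 (chainCount_succ_eq_zero h)
      omega

lemma chainCount_node_eq_zero_iff (k : ℕ) (l r : BinaryTree Unit) :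
    chainCount (k + 2) 0 (word (l △ r)) = 0 ↔
      chainCount (k + 1) 0 (word l) = 0 ∧ chainCount (k + 2) 0 (word r) = 0 := by
  have hc : chainCount (k + 2) 0 (word (l △ r)) = chainCount (k + 2) 0 (word l) +
    chainCount (k + 1) 0 (word l) + chainCount (k + 2) 0 (word r) := chainCount_word_node _ l r
  rw [hc]
  have h : chainCount (k + 1) 0 (word l) = 0 → chainCount (k + 2) 0 (word l) = 0 :=
    chainCount_succ_eq_zero
  omega

lemma chainCount_node_eq_one_iff (k : ℕ) (l r : BinaryTree Unit) :
    chainCount (k + 2) 0 (word (l △ r)) = 1 ↔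
      (chainCount (k + 1) 0 (word l) = 1 ∧ chainCount (k + 2) 0 (word r) = 0) ∨
      (chainCount (k + 1) 0 (word l) = 0 ∧ chainCount (k + 2) 0 (word r) = 1) := by
  have hc : chainCount (k + 2) 0 (word (l △ r)) = chainCount (k + 2) 0 (word l) +
    chainCount (k + 1) 0 (word l) + chainCount (k + 2) 0 (word r) := chainCount_word_node _ l r
  rw [hc]
  have h : chainCount (k + 1) 0 (word l) = 0 → chainCount (k + 2) 0 (word l) = 0 :=
    chainCount_succ_eq_zero
  have h' := @chainCount_eq_zero_of_eq_one k l
  omega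

lemma chainCount_one_word (t : BinaryTree Unit) : chainCount 1 0 (word t) = t.numNodes := by
  induction t with
  | nil => rfl
  | node _ l r hl hr =>
    rw [chainCount_word_node, hl, hr, chainCount_zero, numNodes]
    omega

/-- The permutation coded by the tree `t` alternates, starting with a rise if and only if `b` is
true, and its length is even if and only if `e` is true. The empty permutation and the permutation
of length one count as alternating for both values of `b`. -/
def Shape (b e : Bool) (t : BinaryTree Unit) : Prop :=
  Zigzag b (word t) ∧ (Even t.numNodes ↔ e = true)

lemma numNodes_eq_zero_iff {t : BinaryTree Unit} : t.numNodes = 0 ↔ t = nil := by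
  cases t <;> simp [numNodes]

lemma shape_nil (b e : Bool) : Shape b e nil ↔ e = true := by
  simp [Shape, word, Zigzag, numNodes]

lemma word_eq_nil_iff {t : BinaryTree Unit} : word t = [] ↔ t = nil := by
  rw [← List.length_eq_zero_iff, length_word, numNodes_eq_zero_iff]

lemma zigzag_true_node (l r : BinaryTree Unit) : Zigzag true (word (l △ r)) ↔
    (l = nil ∧ r = nil) ∨ (Odd l.numNodes ∧ Zigzag true (word l) ∧ Zigzag true (word r)) := by
  rw [word, (zigzag_append_cons _ left_lt_root right_lt_root).1, zigzag_map_add, List.length_map,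
    length_word, List.map_eq_nil_iff, word_eq_nil_iff, word_eq_nil_iff]

lemma zigzag_false_node (l r : BinaryTree Unit) : Zigzag false (word (l △ r)) ↔
    Even l.numNodes ∧ Zigzag false (word l) ∧ Zigzag true (word r) := by
  rw [word, (zigzag_append_cons _ left_lt_root right_lt_root).2, zigzag_map_add, List.length_map,
    length_word]

lemma shape_true_false_node (l r : BinaryTree Unit) : Shape true false (l △ r) ↔
    (l = nil ∧ r = nil) ∨ (Shape true false l ∧ Shape true false r) := by
  rw [Shape, zigzag_true_node]
  by_cases h : l = nil ∧ r = nil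
  · obtain ⟨rfl, rfl⟩ := h
    simp [numNodes]
  · simp only [Shape, numNodes, Nat.even_add_one, Nat.even_add, ← Nat.not_even_iff_odd,
      Bool.false_eq_true, iff_false, not_not]
    tauto

lemma shape_true_true_node (l r : BinaryTree Unit) : Shape true true (l △ r) ↔
    Shape true false l ∧ Shape true true r := by
  rw [Shape, zigzag_true_node]
  by_cases h : l = nil ∧ r = nil
  · obtain ⟨rfl, rfl⟩ := h
    simp [numNodes, Shape]
  · simp only [Shape, numNodes, Nat.even_add_one, Nat.even_add, ← Nat.not_even_iff_odd,
      iff_true, Bool.false_eq_true, iff_false]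
    tauto

lemma shape_false_node (e : Bool) (l r : BinaryTree Unit) : Shape false e (l △ r) ↔
    Shape false true l ∧ Shape true (!e) r := by
  rw [Shape, zigzag_false_node]
  simp only [Shape, numNodes, Nat.even_add_one, Nat.even_add]
  cases e <;> simp only [iff_true, Bool.false_eq_true, iff_false, not_not, Bool.not_true,
    Bool.not_false] <;> tauto

/-! ### Generating functions of trees -/

open Classical in
/-- The generating function, by number of nodes, of the binary trees with property `P`. -/
noncomputable def treeGF (P : BinaryTree Unit → Prop) : PowerSeries ℚ :=
  PowerSeries.mk fun n => ∑ t ∈ treesOfNumNodesEq n, if P t then 1 else 0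

lemma coeff_treeGF (P : BinaryTree Unit → Prop) [DecidablePred P] (n : ℕ) :
    PowerSeries.coeff n (treeGF P) = ((treesOfNumNodesEq n).filter P).card := by
  rw [treeGF, PowerSeries.coeff_mk, ← Finset.sum_boole]
  exact Finset.sum_congr rfl fun t _ => by congr

lemma sum_treesOfNumNodesEq_succ (n : ℕ) (F : BinaryTree Unit → ℚ) :
    ∑ t ∈ treesOfNumNodesEq (n + 1), F t = ∑ ij ∈ Finset.HasAntidiagonal.antidiagonal n,
      ∑ l ∈ treesOfNumNodesEq ij.1, ∑ r ∈ treesOfNumNodesEq ij.2, F (l △ r) := by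
  rw [treesOfNumNodesEq_succ, Finset.sum_biUnion]
  · refine Finset.sum_congr rfl fun ij _ => ?_
    rw [← Finset.sum_product', pairwiseNode, Finset.sum_map]
    rfl
  · rintro ⟨i, j⟩ - ⟨i', j'⟩ - hne
    rw [Function.onFun, Finset.disjoint_left]
    intro t ht ht'
    simp only [pairwiseNode, Finset.mem_map, Finset.mem_product, mem_treesOfNumNodesEq,
      Prod.exists] at ht ht'
    obtain ⟨l, r, ⟨rfl, rfl⟩, rfl⟩ := ht
    obtain ⟨l', r', ⟨rfl, rfl⟩, h⟩ := ht'
    simp_all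

open Classical in
/-- The root decomposition of trees, at the level of generating functions. -/
lemma treeGF_eq {P Q₁ R₁ Q₂ R₂ : BinaryTree Unit → Prop}
    (hP : ∀ l r, P (l △ r) ↔ (Q₁ l ∧ R₁ r) ∨ (Q₂ l ∧ R₂ r)) (hQ : ∀ l, Q₁ l → ¬ Q₂ l) :
    treeGF P = (if P nil then 1 else 0) +
      PowerSeries.X * (treeGF Q₁ * treeGF R₁ + treeGF Q₂ * treeGF R₂) := by
  ext n
  cases n with
  | zero => by_cases h : P nil <;> simp [treeGF, h, -Finset.sum_boole]
  | succ n =>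
    have h0 : (PowerSeries.coeff (n + 1)) (if P nil then (1 : PowerSeries ℚ) else 0) = 0 := by
      split_ifs <;> simp [PowerSeries.coeff_one]
    have hsplit : ∀ l r, (if P (l △ r) then (1 : ℚ) else 0) =
        (if Q₁ l then 1 else 0) * (if R₁ r then 1 else 0) +
        (if Q₂ l then 1 else 0) * (if R₂ r then 1 else 0) := by
      intro l r
      have := hQ l
      by_cases h1 : Q₁ l <;> by_cases h2 : Q₂ l <;> by_cases h3 : R₁ r <;>
        by_cases h4 : R₂ r <;> simp_all
    rw [map_add, h0, zero_add, PowerSeries.coeff_succ_X_mul, map_add, PowerSeries.coeff_mul,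
      PowerSeries.coeff_mul, ← Finset.sum_add_distrib]
    simp only [treeGF, PowerSeries.coeff_mk, sum_treesOfNumNodesEq_succ]
    refine Finset.sum_congr rfl fun ij _ => ?_
    simp only [hsplit, Finset.sum_add_distrib, Finset.sum_mul_sum]

lemma treeGF_false : treeGF (fun _ => False) = 0 := by
  ext n
  simp [treeGF]

lemma treeGF_congr {P Q : BinaryTree Unit → Prop} (h : ∀ t, P t ↔ Q t) : treeGF P = treeGF Q := by
  rw [funext fun t => propext (h t)]

/-- The case of `treeGF_eq` with a single product. -/
lemma treeGF_eq_of_and {P Q R : BinaryTree Unit → Prop} (hP : ∀ l r, P (l △ r) ↔ Q l ∧ R r) :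
    (P nil → treeGF P = 1 + PowerSeries.X * (treeGF Q * treeGF R)) ∧
    (¬ P nil → treeGF P = PowerSeries.X * (treeGF Q * treeGF R)) := by
  classical
  have h := treeGF_eq (P := P) (Q₁ := Q) (R₁ := R) (Q₂ := fun _ => False) (R₂ := fun _ => False)
    (by simpa using hP) (by simp)
  rw [treeGF_false, mul_zero, add_zero] at h
  constructor <;> intro h0 <;> simpa [h0] using h

lemma treeGF_eq_nil : treeGF (fun t => t = nil) = 1 := by
  have h := (treeGF_eq_of_and (P := fun t => t = nil) (Q := fun _ => False) (R := fun _ => False)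
    (by simp)).1 rfl
  rw [h, treeGF_false, mul_zero, mul_zero, add_zero]

/-! ### Recursions for alternating permutations -/

/-- The generating function of the alternating `1-3-2`-avoiding permutations of the given shape with
exactly `s` increasing subsequences of length `k + 1`. The shift excludes length `0`. -/
noncomputable def shapeGF (b e : Bool) (s k : ℕ) : PowerSeries ℚ :=
  treeGF fun t => Shape b e t ∧ chainCount (k + 1) 0 (word t) = s

lemma shapeGF_zero_zero (b e : Bool) : shapeGF b e 0 0 = if e = true then 1 else 0 := by
  rw [shapeGF, treeGF_congr (Q := fun t => e = true ∧ t = nil)]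
  · cases e <;> simp [treeGF_eq_nil, treeGF_false]
  · intro t
    rw [chainCount_one_word, numNodes_eq_zero_iff]
    constructor
    · rintro ⟨h, rfl⟩
      exact ⟨(shape_nil b e).1 h, rfl⟩
    · rintro ⟨h, rfl⟩
      exact ⟨(shape_nil b e).2 h, rfl⟩

lemma shapeGF_one_zero_of_even (b : Bool) : shapeGF b true 1 0 = 0 := by
  rw [shapeGF, treeGF_congr (Q := fun _ => False), treeGF_false]
  intro t
  simp only [Shape, iff_true, iff_false]
  rintro ⟨⟨-, h⟩, h1⟩
  have h2 : t.numNodes = 1 := (chainCount_one_word t).symm.trans h1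
  simp [h2] at h

lemma numNodes_eq_one_iff {t : BinaryTree Unit} : t.numNodes = 1 ↔ t = nil △ nil := by
  cases t with
  | nil => simp [numNodes]
  | node _ l r => simp [numNodes, numNodes_eq_zero_iff]

lemma shapeGF_one_zero_of_odd (b : Bool) : shapeGF b false 1 0 = PowerSeries.X := by
  have h := (treeGF_eq_of_and (P := fun t => Shape b false t ∧ chainCount 1 0 (word t) = 1)
    (Q := fun t => t = nil) (R := fun t => t = nil) ?_).2 (by simp [word])
  · rw [treeGF_eq_nil, mul_one, mul_one] at h
    exact h
  · intro l r
    rw [chainCount_one_word, numNodes_eq_one_iff]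
    constructor
    · rintro ⟨-, h⟩
      simpa using h
    · rintro ⟨rfl, rfl⟩
      simp [Shape, numNodes, word, Zigzag]

lemma shapeGF_up_odd_zero_succ (k : ℕ) : shapeGF true false 0 (k + 1) = PowerSeries.X +
    PowerSeries.X * (shapeGF true false 0 k * shapeGF true false 0 (k + 1)) := by
  classical
  refine (treeGF_eq (Q₁ := fun t => t = nil) (R₁ := fun t => t = nil)
    (Q₂ := fun t => Shape true false t ∧ chainCount (k + 1) 0 (word t) = 0)
    (R₂ := fun t => Shape true false t ∧ chainCount (k + 2) 0 (word t) = 0) ?_ ?_).trans ?_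
  · intro l r
    rw [shape_true_false_node, chainCount_node_eq_zero_iff]
    have h : l = nil ∧ r = nil →
        chainCount (k + 1) 0 (word l) = 0 ∧ chainCount (k + 2) 0 (word r) = 0 := by
      rintro ⟨rfl, rfl⟩
      exact ⟨rfl, rfl⟩
    tauto
  · rintro l rfl
    simp [shape_nil]
  · rw [if_neg (by simp [shape_nil]), treeGF_eq_nil, zero_add, mul_one, mul_add, mul_one]
    rfl

lemma shapeGF_up_even_zero_succ (k : ℕ) : shapeGF true true 0 (k + 1) =
    1 + PowerSeries.X * (shapeGF true false 0 k * shapeGF true true 0 (k + 1)) := by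
  refine (treeGF_eq_of_and fun l r => ?_).1 ⟨(shape_nil _ _).2 rfl, rfl⟩
  rw [shape_true_true_node, chainCount_node_eq_zero_iff]
  tauto

lemma shapeGF_down_even_zero_succ (k : ℕ) : shapeGF false true 0 (k + 1) =
    1 + PowerSeries.X * (shapeGF false true 0 k * shapeGF true false 0 (k + 1)) := by
  refine (treeGF_eq_of_and fun l r => ?_).1 ⟨(shape_nil _ _).2 rfl, rfl⟩
  rw [shape_false_node, chainCount_node_eq_zero_iff]
  tauto

/-- The unique increasing subsequence of length `k + 2` either ends with the largest letter, and then
it comes from the unique one of length `k + 1` before that letter, or it lies after that letter. -/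
lemma shapeGF_one_succ {b e b₁ e₁ b₂ e₂ : Bool} (k : ℕ)
    (h : ∀ l r, (l ≠ nil ∨ r ≠ nil) → (Shape b e (l △ r) ↔ Shape b₁ e₁ l ∧ Shape b₂ e₂ r)) :
    shapeGF b e 1 (k + 1) = PowerSeries.X *
      (shapeGF b₁ e₁ 1 k * shapeGF b₂ e₂ 0 (k + 1) +
        shapeGF b₁ e₁ 0 k * shapeGF b₂ e₂ 1 (k + 1)) := by
  classical
  rw [shapeGF, treeGF_eq
    (Q₁ := fun t => Shape b₁ e₁ t ∧ chainCount (k + 1) 0 (word t) = 1)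
    (R₁ := fun t => Shape b₂ e₂ t ∧ chainCount (k + 2) 0 (word t) = 0)
    (Q₂ := fun t => Shape b₁ e₁ t ∧ chainCount (k + 1) 0 (word t) = 0)
    (R₂ := fun t => Shape b₂ e₂ t ∧ chainCount (k + 2) 0 (word t) = 1)]
  · simp [word, shapeGF]
  · intro l r
    rw [chainCount_node_eq_one_iff]
    by_cases hlr : l ≠ nil ∨ r ≠ nil
    · rw [h l r hlr]
      tauto
    · push Not at hlr
      obtain ⟨rfl, rfl⟩ := hlr
      simp [word]
  · rintro l ⟨-, h1⟩ ⟨-, h2⟩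
    omega

lemma shapeGF_up_odd_one_succ (k : ℕ) : shapeGF true false 1 (k + 1) = PowerSeries.X *
    (shapeGF true false 1 k * shapeGF true false 0 (k + 1) +
      shapeGF true false 0 k * shapeGF true false 1 (k + 1)) :=
  shapeGF_one_succ k fun l r h => by rw [shape_true_false_node]; tauto

lemma shapeGF_up_even_one_succ (k : ℕ) : shapeGF true true 1 (k + 1) = PowerSeries.X *
    (shapeGF true false 1 k * shapeGF true true 0 (k + 1) +
      shapeGF true false 0 k * shapeGF true true 1 (k + 1)) :=
  shapeGF_one_succ k fun l r _ => shape_true_true_node l r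

lemma shapeGF_down_one_succ (e : Bool) (k : ℕ) : shapeGF false e 1 (k + 1) = PowerSeries.X *
    (shapeGF false true 1 k * shapeGF true (!e) 0 (k + 1) +
      shapeGF false true 0 k * shapeGF true (!e) 1 (k + 1)) :=
  shapeGF_one_succ k fun l r _ => shape_false_node e l r

/-! ### From permutations to trees -/

/-- Counting permutations by counting trees, for any class of permutations that can be read off
from the one-line notation. -/
lemma genFun_eq_treeGF (P : ∀ {n : ℕ}, Equiv.Perm (Fin n) → Prop) (k : ℕ) (Q : List ℕ → Prop)
    (h : ∀ (n : ℕ) (π : Equiv.Perm (Fin n)), chainCount k 0 (oneLine π) = 1 →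
      (P π ↔ Q (oneLine π))) :
    genFun P (increasingPattern k) 1 =
      ((treeGF fun t => Q (word t) ∧ chainCount k 0 (word t) = 1 : PowerSeries ℚ) :
        LaurentSeries ℚ) := by
  classical
  rw [genFun]
  congr 1
  ext n
  rw [coeff_treeGF, PowerSeries.coeff_mk, restrictedCount, Nat.cast_inj]
  have h1 : ((↑) : _ → Set (List ℕ)) (((treesOfNumNodesEq n).filter fun t =>
      Q (word t) ∧ chainCount k 0 (word t) = 1).image word) =
      oneLine '' {π : Equiv.Perm (Fin n) |
        P π ∧ Avoids pattern132 π ∧ occurrences (increasingPattern k) π = 1} := by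
    ext w
    simp only [Finset.coe_image, Finset.coe_filter, mem_treesOfNumNodesEq, Set.mem_image,
      Set.mem_ofPred_eq, occurrences_increasingPattern, avoids_pattern132_iff]
    constructor
    · rintro ⟨t, ⟨rfl, hQ, hc⟩, rfl⟩
      obtain ⟨π, hπ⟩ := exists_oneLine_eq (length_word t) (nodup_word t) fun a => lt_of_mem_word
      refine ⟨π, ⟨?_, ?_, ?_⟩, hπ⟩
      · rw [h _ _ (hπ ▸ hc), hπ]
        exact hQ
      · rw [hπ]
        exact avoids132_word t
      · rw [hπ]
        exact hc
    · rintro ⟨π, ⟨hP, hav, hc⟩, rfl⟩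
      obtain ⟨t, ht⟩ := exists_word_eq (oneLine π) (nodup_oneLine π)
        (by simpa using lt_of_mem_oneLine π) hav
      refine ⟨t, ⟨by rw [← length_word, ht, length_oneLine], ?_, ht ▸ hc⟩, ht⟩
      rw [ht, ← h _ _ hc]
      exact hP
  rw [← Finset.card_image_of_injective _ word_injective, ← Set.ncard_coe_finset, h1,
    Set.ncard_image_of_injective _ (oneLine_injective n), ← Nat.card_coe_set_eq]
  rfl

lemma two_le_of_chainCount_eq_one {k n : ℕ} {π : Equiv.Perm (Fin n)}
    (h : chainCount (k + 2) 0 (oneLine π) = 1) : 2 ≤ n := by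
  by_contra! hn
  rw [chainCount_eq_zero_of_length_lt 0 (by rw [length_oneLine]; omega)] at h
  omega

lemma genFun_eq_shapeGF (P : ∀ {n : ℕ}, Equiv.Perm (Fin n) → Prop) (b e : Bool) (k : ℕ)
    (h : ∀ (n : ℕ) (π : Equiv.Perm (Fin n)), 2 ≤ n →
      (P π ↔ Zigzag b (oneLine π) ∧ (Even n ↔ e = true))) :
    genFun P (increasingPattern (k + 2)) 1 = (shapeGF b e 1 (k + 1) : LaurentSeries ℚ) := by
  rw [genFun_eq_treeGF P (k + 2) fun w => Zigzag b w ∧ (Even w.length ↔ e = true)]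
  · simp only [shapeGF, Shape, length_word]
  · intro n π hc
    rw [length_oneLine]
    exact h n π (two_le_of_chainCount_eq_one hc)

lemma first_last_iff {n : ℕ} (hn : 2 ≤ n) (π : Equiv.Perm (Fin n)) (b e : Bool) :
    (2 ≤ n ∧ IsZigzag π ∧ (IsRise π 0 ↔ b = true) ∧
      (IsRise π (n - 2) ↔ (e = true ↔ b = true))) ↔
      Zigzag b (oneLine π) ∧ (Even n ↔ e = true) := by
  rw [← and_assoc (a := IsZigzag π), isZigzag_and_iff hn]
  constructor
  · rintro ⟨-, hz, hl⟩
    rw [isRise_last_iff hn hz] at hl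
    refine ⟨hz, ?_⟩
    tauto
  · rintro ⟨hz, he⟩
    refine ⟨hn, hz, ?_⟩
    rw [isRise_last_iff hn hz, he]

lemma genFun_isUpDown (k : ℕ) : genFun IsUpDown (increasingPattern (k + 2)) 1 =
    (shapeGF true false 1 (k + 1) : LaurentSeries ℚ) :=
  genFun_eq_shapeGF _ true false k fun n π hn => by
    rw [← first_last_iff hn, IsUpDown, isDescent_iff_not_isRise π (by omega)]
    simp

lemma genFun_isUpUp (k : ℕ) : genFun IsUpUp (increasingPattern (k + 2)) 1 =
    (shapeGF true true 1 (k + 1) : LaurentSeries ℚ) :=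
  genFun_eq_shapeGF _ true true k fun n π hn => by
    rw [← first_last_iff hn, IsUpUp]
    simp

lemma genFun_isDownDown (k : ℕ) : genFun IsDownDown (increasingPattern (k + 2)) 1 =
    (shapeGF false true 1 (k + 1) : LaurentSeries ℚ) :=
  genFun_eq_shapeGF _ false true k fun n π hn => by
    rw [← first_last_iff hn, IsDownDown, isDescent_iff_not_isRise π (by omega),
      isDescent_iff_not_isRise π (by omega)]
    simp

lemma genFun_isDownUp (k : ℕ) : genFun IsDownUp (increasingPattern (k + 2)) 1 =
    (shapeGF false false 1 (k + 1) : LaurentSeries ℚ) :=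
  genFun_eq_shapeGF _ false false k fun n π hn => by
    rw [← first_last_iff hn, IsDownUp, isDescent_iff_not_isRise π (by omega)]
    simp

lemma isAlternating_iff {n : ℕ} (π : Equiv.Perm (Fin n)) :
    IsAlternating π ↔ Zigzag true (oneLine π) := by
  rw [zigzag_oneLine_iff, IsAlternating]
  refine forall_congr' fun i => forall_congr' fun hi => ?_
  rw [isDescent_iff_not_isRise π hi, ← Nat.not_even_iff_odd, iff_true_right rfl]
  tauto

lemma genFun_isAlternating (k : ℕ) : genFun IsAlternating (increasingPattern (k + 2)) 1 =
    (shapeGF true false 1 (k + 1) : LaurentSeries ℚ) +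
      (shapeGF true true 1 (k + 1) : LaurentSeries ℚ) := by
  classical
  rw [genFun_eq_treeGF IsAlternating (k + 2) (Zigzag true) fun n π _ => isAlternating_iff π,
    ← map_add]
  congr 1
  ext n
  simp only [shapeGF, treeGF, Shape, map_add, PowerSeries.coeff_mk, ← Finset.sum_add_distrib]
  refine Finset.sum_congr rfl fun t _ => ?_
  by_cases h : Even t.numNodes <;> simp [h]

/-! ### Chebyshev polynomials at `1 / (2x)` -/

lemma x_ne_zero : x ≠ 0 := by
  rw [x, Ne, map_eq_zero_iff _ HahnSeries.ofPowerSeries_injective]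
  exact PowerSeries.X_ne_zero

@[simp] lemma chebU_zero : chebU 0 = 1 := by simp [chebU]

@[simp] lemma chebU_neg_one : chebU (-1) = 0 := by simp [chebU]

lemma x_mul_chebU_add_one (n : ℤ) : x * chebU (n + 1) = chebU n - x * chebU (n - 1) := by
  have hx := x_ne_zero
  have h2 : (2 : LaurentSeries ℚ) ≠ 0 := by
    simpa using (map_ne_zero (algebraMap ℚ (LaurentSeries ℚ))).2 (two_ne_zero (α := ℚ))
  rw [chebU, Polynomial.Chebyshev.U_add_one]
  simp only [Polynomial.eval_sub, Polynomial.eval_mul, Polynomial.eval_ofNat, Polynomial.eval_X]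
  change x * (2 * (1 / (2 * x)) * chebU n - chebU (n - 1)) = _
  field_simp

/-- Clearing the pole of `U_n(1/(2x))` gives a power series with constant coefficient one. -/
lemma exists_x_pow_mul_chebU (n : ℕ) :
    (∃ p : PowerSeries ℚ, PowerSeries.constantCoeff p = 1 ∧
      x ^ n * chebU n = (p : LaurentSeries ℚ)) ∧
    ∃ p : PowerSeries ℚ, PowerSeries.constantCoeff p = 1 ∧
      x ^ (n + 1) * chebU (n + 1) = (p : LaurentSeries ℚ) := by
  induction n with
  | zero =>
    refine ⟨⟨1, by simp, by simp⟩, ⟨1, by simp, ?_⟩⟩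
    have h := x_mul_chebU_add_one 0
    simp only [zero_add, zero_sub, chebU_neg_one, mul_zero, sub_zero, chebU_zero] at h
    simpa using h
  | succ n ih =>
    obtain ⟨⟨p, hp1, hp⟩, ⟨q, hq1, hq⟩⟩ := ih
    refine ⟨⟨q, hq1, by exact_mod_cast hq⟩, ⟨q - PowerSeries.X ^ 2 * p, by simp [hq1], ?_⟩⟩
    have h := x_mul_chebU_add_one (n + 1)
    rw [add_sub_cancel_right] at h
    rw [map_sub, map_mul, map_pow, ← hp, ← hq]
    change _ = _ - x ^ 2 * _
    push_cast
    linear_combination x ^ (n + 1) * h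

lemma chebU_ne_zero (n : ℕ) : chebU n ≠ 0 := by
  obtain ⟨⟨p, hp1, hp⟩, -⟩ := exists_x_pow_mul_chebU n
  intro h
  rw [h, mul_zero, eq_comm, map_eq_zero_iff _ HahnSeries.ofPowerSeries_injective] at hp
  simp [hp] at hp1

lemma chebU_succ_ne_zero (n : ℕ) : chebU (n + 1) ≠ 0 := by
  exact_mod_cast chebU_ne_zero (n + 1)

/-! ### Solving the recursions -/

/-- The Laurent series of `shapeGF`. -/
noncomputable def shapeLS (b e : Bool) (s k : ℕ) : LaurentSeries ℚ :=
  (shapeGF b e s k : LaurentSeries ℚ)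

/-- The solution of the linear equation to which each of the recursions leads. -/
lemma chebU_of_linear {k : ℕ} {p y c : LaurentSeries ℚ} (hp : p * chebU k = chebU (k - 1))
    (hy : y = c + x * (p * y)) : y * (x * chebU (k + 1)) = c * chebU k := by
  rw [x_mul_chebU_add_one]
  linear_combination chebU k * hy + x * y * hp

lemma shapeLS_up_odd_zero (k : ℕ) : shapeLS true false 0 k * chebU k = chebU (k - 1) := by
  induction k with
  | zero => simp [shapeLS, shapeGF_zero_zero]
  | succ k ih =>
    have h : shapeLS true false 0 (k + 1) =
        x + x * (shapeLS true false 0 k * shapeLS true false 0 (k + 1)) := by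
      conv_lhs => rw [shapeLS, shapeGF_up_odd_zero_succ, map_add, map_mul, map_mul]
      rfl
    have := chebU_of_linear ih h
    push_cast
    rw [add_sub_cancel_right]
    apply mul_left_cancel₀ x_ne_zero
    linear_combination this

lemma shapeLS_up_even_zero_succ (k : ℕ) :
    shapeLS true true 0 (k + 1) * (x * chebU (k + 1)) = chebU k := by
  have h : shapeLS true true 0 (k + 1) =
      1 + x * (shapeLS true false 0 k * shapeLS true true 0 (k + 1)) := by
    conv_lhs => rw [shapeLS, shapeGF_up_even_zero_succ, map_add, map_mul, map_mul, map_one]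
    rfl
  simpa using chebU_of_linear (shapeLS_up_odd_zero k) h

lemma shapeLS_up_odd_zero_succ (k : ℕ) :
    shapeLS true false 0 (k + 1) * chebU (k + 1) = chebU k := by
  simpa using shapeLS_up_odd_zero (k + 1)

lemma shapeLS_up_odd_one (k : ℕ) : shapeLS true false 1 k * chebU k ^ 2 = x := by
  induction k with
  | zero => simp [shapeLS, shapeGF_one_zero_of_odd, x]
  | succ k ih =>
    have h : shapeLS true false 1 (k + 1) =
        x * (shapeLS true false 1 k * shapeLS true false 0 (k + 1)) +
          x * (shapeLS true false 0 k * shapeLS true false 1 (k + 1)) := by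
      conv_lhs => rw [shapeLS, shapeGF_up_odd_one_succ, map_mul, map_add, map_mul, map_mul, mul_add]
      rfl
    have := chebU_of_linear (shapeLS_up_odd_zero k) h
    push_cast
    apply mul_left_cancel₀ x_ne_zero
    linear_combination chebU (k + 1) * this + x * ih +
      x * shapeLS true false 1 k * chebU k * shapeLS_up_odd_zero_succ k

lemma shapeLS_up_even_one_succ (k : ℕ) : shapeLS true true 1 (k + 1) * chebU (k + 1) ^ 2 = 1 := by
  have h : shapeLS true true 1 (k + 1) =
      x * (shapeLS true false 1 k * shapeLS true true 0 (k + 1)) +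
        x * (shapeLS true false 0 k * shapeLS true true 1 (k + 1)) := by
    conv_lhs => rw [shapeLS, shapeGF_up_even_one_succ, map_mul, map_add, map_mul, map_mul, mul_add]
    rfl
  have := chebU_of_linear (shapeLS_up_odd_zero k) h
  apply mul_left_cancel₀ x_ne_zero
  linear_combination chebU (k + 1) * this + shapeLS_up_odd_one k +
    shapeLS true false 1 k * chebU k * shapeLS_up_even_zero_succ k

lemma x_mul_shapeLS_up_even_zero_succ (k : ℕ) :
    x * shapeLS true true 0 (k + 1) = shapeLS true false 0 (k + 1) := by
  apply mul_right_cancel₀ (chebU_succ_ne_zero k)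
  linear_combination shapeLS_up_even_zero_succ k - shapeLS_up_odd_zero_succ k

lemma x_mul_shapeLS_up_even_one_succ (k : ℕ) :
    x * shapeLS true true 1 (k + 1) = shapeLS true false 1 (k + 1) := by
  apply mul_right_cancel₀ (pow_ne_zero 2 (chebU_succ_ne_zero k))
  have := shapeLS_up_odd_one (k + 1)
  push_cast at this
  linear_combination x * shapeLS_up_even_one_succ k - this

lemma x_mul_shapeLS_down_even_zero (k : ℕ) :
    x * chebU k * shapeLS false true 0 k = x ^ (k + 1) + chebU (k - 1) := by
  induction k with
  | zero => simp [shapeLS, shapeGF_zero_zero]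
  | succ k ih =>
    have h : shapeLS false true 0 (k + 1) =
        1 + x * (shapeLS false true 0 k * shapeLS true false 0 (k + 1)) := by
      conv_lhs => rw [shapeLS, shapeGF_down_even_zero_succ, map_add, map_mul, map_mul, map_one]
      rfl
    push_cast
    rw [add_sub_cancel_right]
    linear_combination x * chebU (k + 1) * h + x * ih + x_mul_chebU_add_one k +
      x ^ 2 * shapeLS false true 0 k * shapeLS_up_odd_zero_succ k

lemma shapeLS_down_one_succ (e : Bool) (k : ℕ) : shapeLS false e 1 (k + 1) =
    x * (shapeLS false true 1 k * shapeLS true (!e) 0 (k + 1) +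
      shapeLS false true 0 k * shapeLS true (!e) 1 (k + 1)) := by
  conv_lhs => rw [shapeLS, shapeGF_down_one_succ, map_mul, map_add, map_mul, map_mul]
  rfl

lemma x_mul_shapeLS_down_odd_one_succ (k : ℕ) :
    x * shapeLS false false 1 (k + 1) = shapeLS false true 1 (k + 1) := by
  rw [shapeLS_down_one_succ, shapeLS_down_one_succ, Bool.not_false, Bool.not_true,
    ← x_mul_shapeLS_up_even_one_succ, ← x_mul_shapeLS_up_even_zero_succ]
  ring

lemma chebU_mul_shapeLS_down_even_one (k : ℕ) :
    chebU k * shapeLS false true 1 k = ∑ m ∈ Finset.range k,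
      x ^ (k - m) * (x ^ (m + 1) + chebU (m - 1)) / (chebU m * chebU (m + 1)) := by
  induction k with
  | zero => simp [shapeLS, shapeGF_one_zero_of_even]
  | succ k ih =>
    have hsum : ∑ m ∈ Finset.range k,
        x ^ (k + 1 - m) * (x ^ (m + 1) + chebU (m - 1)) / (chebU m * chebU (m + 1)) =
        x * (chebU k * shapeLS false true 1 k) := by
      rw [ih, Finset.mul_sum]
      refine Finset.sum_congr rfl fun m hm => ?_
      rw [Nat.succ_sub (Finset.mem_range.1 hm).le, pow_succ]
      ring
    have h := shapeLS_down_one_succ true k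
    have h1 := shapeLS_up_odd_one (k + 1)
    have hk := chebU_ne_zero k
    have hk1 := chebU_succ_ne_zero k
    rw [Finset.sum_range_succ, hsum, ← x_mul_shapeLS_down_even_zero]
    push_cast at h1 ⊢
    rw [Nat.add_sub_cancel_left, pow_one]
    field_simp
    rw [Bool.not_true] at h
    linear_combination chebU (k + 1) ^ 2 * h + x * shapeLS false true 0 k * h1 +
      x * shapeLS false true 1 k * chebU (k + 1) * shapeLS_up_odd_zero_succ k

end AltPerm

theorem theorem3p1 (k : ℕ) (hk : 2 ≤ k) :
    AltPerm.genFun AltPerm.IsUpDown (AltPerm.increasingPattern k) 1 =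
        AltPerm.x / AltPerm.chebU (k - 1) ^ 2 ∧
    AltPerm.genFun AltPerm.IsDownDown (AltPerm.increasingPattern k) 1 =
        1 / AltPerm.chebU (k - 1) *
          ∑ m ∈ Finset.range (k - 1),
            AltPerm.x ^ (k - 1 - m) * (AltPerm.x ^ (m + 1) + AltPerm.chebU (m - 1)) /
              (AltPerm.chebU m * AltPerm.chebU (m + 1)) ∧
    AltPerm.genFun AltPerm.IsUpUp (AltPerm.increasingPattern k) 1 =
        1 / AltPerm.chebU (k - 1) ^ 2 ∧
    AltPerm.genFun AltPerm.IsDownUp (AltPerm.increasingPattern k) 1 =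
        1 / (AltPerm.x * AltPerm.chebU (k - 1)) *
          ∑ m ∈ Finset.range (k - 1),
            AltPerm.x ^ (k - 1 - m) * (AltPerm.x ^ (m + 1) + AltPerm.chebU (m - 1)) /
              (AltPerm.chebU m * AltPerm.chebU (m + 1)) ∧
    AltPerm.genFun AltPerm.IsAlternating (AltPerm.increasingPattern k) 1 =
        (1 + AltPerm.x) / AltPerm.chebU (k - 1) ^ 2 := by
  obtain ⟨k, rfl⟩ := Nat.exists_eq_add_of_le' hk
  have hc : ((k + 2 : ℕ) : ℤ) - 1 = k + 1 := by push_cast; ring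
  have hx := AltPerm.x_ne_zero
  have hU := AltPerm.chebU_succ_ne_zero k
  have hU2 := pow_ne_zero 2 hU
  have hud := AltPerm.shapeLS_up_odd_one (k + 1)
  have huu := AltPerm.shapeLS_up_even_one_succ k
  have hdd := AltPerm.chebU_mul_shapeLS_down_even_one (k + 1)
  have hdu := AltPerm.x_mul_shapeLS_down_odd_one_succ k
  push_cast at hud hdd
  rw [hc, show k + 2 - 1 = k + 1 from rfl, AltPerm.genFun_isUpDown, AltPerm.genFun_isDownDown,
    AltPerm.genFun_isUpUp, AltPerm.genFun_isDownUp, AltPerm.genFun_isAlternating, ← hdd]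
  simp only [AltPerm.shapeLS] at hud huu hdu ⊢
  refine ⟨?_, ?_, ?_, ?_, ?_⟩
  · rw [eq_div_iff hU2, hud]
  · field_simp
  · rw [eq_div_iff hU2, huu]
  · rw [← hdu]
    field_simp
  · rw [eq_div_iff hU2, add_mul, hud, huu, add_comm]
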